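/- Let $n\ge 0$. A sign pattern $\mathcal{A}$ of order $n$ is an $n\times n$ matrix with entries in $\{+,-,0\}$, and $Q(\mathcal{A})$ is the set of all real $n\times n$ matrices $A$ such that $A_{ij}>0$ if $\mathcal{A}_{ij}=+$, $A_{ij}<0$ if $\mathcal{A}_{ij}=-$, and $A_{ij}=0$ if $\mathcal{A}_{ij}=0$. The pattern $\mathcal{A}$ allows a property of real matrices if some $A\in Q(\mathcal{A})$ has that property. A real $n\times n$ matrix $A$ has distinct eigenvalues if it has $n$ distinct eigenvalues in $\mathbb{C}$. It has the non-symmetric strong multiplicity property (nSMP) if the only real $n\times n$ matrix $X$ with $$A\circ X=O,\qquad AX^T-X^TA=O,\qquad \operatorname{tr}(X^TA^k)=0\ \text{ for all } 0\le k<n$$ is $X=O$, where $\circ$ is the entrywise (Hadamard) product. Theorem. An $n\times n$ sign pattern $\mathcal{A}$ allows the nSMP if and only if $\mathcal{A}$ allows distinct eigenvalues. Moreover, every real $n\times n$ matrix that has distinct eigenvalues has the nSMP. -/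

import Mathlib

open scoped Matrix

namespace SignPat

/-- An `n × n` sign pattern: a matrix with entries in `{+, -, 0}`. -/
abbrev SignPattern (n : ℕ) : Type := Matrix (Fin n) (Fin n) SignType

/-- The qualitative class `Q(𝒜)`: the real matrices whose entries have the signs prescribed
by `𝒜`. -/
def qualitativeClass {n : ℕ} (𝒜 : SignPattern n) : Set (Matrix (Fin n) (Fin n) ℝ) :=
  {A | ∀ i j, SignType.sign (A i j) = 𝒜 i j}

/-- A pattern allows a property `P` of real matrices if some matrix in `Q(𝒜)` has `P`. -/
def Allows {n : ℕ} (𝒜 : SignPattern n) (P : Matrix (Fin n) (Fin n) ℝ → Prop) : Prop :=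
  ∃ A ∈ qualitativeClass 𝒜, P A

/-- The non-symmetric strong multiplicity property of a real `n × n` matrix. -/
def HasNSMP {n : ℕ} (A : Matrix (Fin n) (Fin n) ℝ) : Prop :=
  ∀ X : Matrix (Fin n) (Fin n) ℝ,
    Matrix.hadamard A X = 0 →
    A * Xᵀ - Xᵀ * A = 0 →
    (∀ k : ℕ, k < n → (Xᵀ * A ^ k).trace = 0) →
    X = 0

/-- `q(A)`: the number of distinct (complex) eigenvalues of the real matrix `A`. -/
noncomputable def numDistinctEigenvalues {n : ℕ} (A : Matrix (Fin n) (Fin n) ℝ) : ℕ :=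
  (spectrum ℂ (A.map ((↑) : ℝ → ℂ))).ncard

/-- A real `n × n` matrix has distinct eigenvalues if it has `n` distinct complex eigenvalues. -/
def HasDistinctEigenvalues {n : ℕ} (A : Matrix (Fin n) (Fin n) ℝ) : Prop :=
  numDistinctEigenvalues A = n

end SignPat

/-!
Let `A` be a real matrix with distinct eigenvalues and suppose that `Xᵀ` commutes with `A`. In an
eigenbasis of `A` the matrix `Xᵀ` is diagonal, and the equations `tr (Xᵀ Aᵏ) = 0` for `k < n` form
a Vandermonde system for its diagonal, so `X = 0`. This is
`eq_zero_of_commute_of_trace_mul_pow_eq_zero`; it proves that `A` has the nSMP without using the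
condition `A ∘ X = 0`.

For the converse on patterns, the three conditions on `X` say that `X` is orthogonal, for the form
`tr (Xᵀ Z)`, to the matrices supported on the pattern of `A`, to the commutators with `A`, and to
the powers `Aᵏ` with `k < n`. So `A` has the nSMP exactly when these three spaces span all matrices,
and the half of this used here is `HasNSMP.range_eq_top`. Their sum is the range of the derivative
at the origin of the map `deformation`,
`(D, Y, c) ↦ (1 + Y) (B + ∑ k, c k • Bᵏ) (1 + Y)⁻¹` with `B = A + D`, where `D` is supported on the
pattern of `A`. If that derivative is onto, every neighbourhood of the origin is mapped onto a
neighbourhood of `A`. Matrices with distinct eigenvalues are dense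
(`dense_separable_charpoly_line` gives what is needed), hence some value of the map, with `D`, `Y`
and `c` small, has distinct eigenvalues. That value is similar to a polynomial in `B`, and by the
spectral mapping theorem a polynomial in `B` has at most as many eigenvalues as `B`
(`hasDistinctEigenvalues_of_aeval`). Hence `B` has distinct eigenvalues, and for small `D` it has
the same sign pattern as `A`.
-/

namespace SignPat

open Polynomial Matrix

variable {n : ℕ}

/-! ### Counting eigenvalues -/

theorem numDistinctEigenvalues_eq_card_roots (A : Matrix (Fin n) (Fin n) ℝ) :
    numDistinctEigenvalues A = (A.map ((↑) : ℝ → ℂ)).charpoly.roots.toFinset.card := by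
  have h : spectrum ℂ (A.map ((↑) : ℝ → ℂ)) =
      ((A.map ((↑) : ℝ → ℂ)).charpoly.roots.toFinset : Set ℂ) := by
    ext z
    simp [Matrix.mem_spectrum_iff_isRoot_charpoly, (Matrix.charpoly_monic _).ne_zero]
  rw [numDistinctEigenvalues, h, Set.ncard_coe_finset]

theorem card_roots_charpoly_map (A : Matrix (Fin n) (Fin n) ℝ) :
    (A.map ((↑) : ℝ → ℂ)).charpoly.roots.card = n := by
  rw [← (IsAlgClosed.splits _).natDegree_eq_card_roots, Matrix.charpoly_natDegree_eq_dim,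
    Fintype.card_fin]

theorem numDistinctEigenvalues_le (A : Matrix (Fin n) (Fin n) ℝ) :
    numDistinctEigenvalues A ≤ n := by
  rw [numDistinctEigenvalues_eq_card_roots]
  exact (Multiset.toFinset_card_le _).trans_eq (card_roots_charpoly_map A)

theorem hasDistinctEigenvalues_iff_separable (A : Matrix (Fin n) (Fin n) ℝ) :
    HasDistinctEigenvalues A ↔ A.charpoly.Separable := by
  have hmap : (A.map ((↑) : ℝ → ℂ)).charpoly = A.charpoly.map Complex.ofRealHom :=
    Matrix.charpoly_map A Complex.ofRealHom
  rw [HasDistinctEigenvalues, numDistinctEigenvalues_eq_card_roots,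
    ← Polynomial.separable_map Complex.ofRealHom, ← hmap,
    ← Polynomial.nodup_roots_iff_of_splits (Matrix.charpoly_monic _).ne_zero
      (IsAlgClosed.splits _), ← Multiset.toFinset_card_eq_card_iff_nodup,
    card_roots_charpoly_map]

theorem hasDistinctEigenvalues_of_units_conj {A : Matrix (Fin n) (Fin n) ℝ}
    (u : (Matrix (Fin n) (Fin n) ℝ)ˣ)
    (h : HasDistinctEigenvalues (u.val * A * u⁻¹.val)) : HasDistinctEigenvalues A := by
  rw [hasDistinctEigenvalues_iff_separable, Matrix.coe_units_inv,
    Matrix.charpoly_units_conj] at h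
  rwa [hasDistinctEigenvalues_iff_separable]

/-- By the spectral mapping theorem a polynomial cannot separate eigenvalues that coincide. -/
theorem hasDistinctEigenvalues_of_aeval {A : Matrix (Fin n) (Fin n) ℝ} (p : ℝ[X])
    (h : HasDistinctEigenvalues (aeval A p)) : HasDistinctEigenvalues A := by
  refine le_antisymm (numDistinctEigenvalues_le A) ?_
  rcases n.eq_zero_or_pos with rfl | hn
  · exact Nat.zero_le _
  have : Nonempty (Fin n) := ⟨⟨0, hn⟩⟩
  have hmap : (aeval A p).map ((↑) : ℝ → ℂ) =
      aeval (A.map ((↑) : ℝ → ℂ)) (p.map (algebraMap ℝ ℂ)) := by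
    rw [Polynomial.aeval_map_algebraMap]
    exact (Polynomial.aeval_algHom_apply ((Algebra.ofId ℝ ℂ).mapMatrix) A p).symm
  calc n = numDistinctEigenvalues (aeval A p) := h.symm
    _ ≤ numDistinctEigenvalues A := by
      rw [numDistinctEigenvalues, hmap, spectrum.map_polynomial_aeval_of_nonempty _ _
        (spectrum.nonempty_of_isAlgClosed_of_finiteDimensional ℂ _)]
      exact Set.ncard_image_le (Matrix.finite_spectrum _)

/-! ### Distinct eigenvalues imply the nSMP -/

/-- A matrix commuting with a diagonalizable matrix `M` with simple eigenvalues is diagonal in an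
eigenbasis of `M`, and then its traces against the powers of `M` determine its diagonal through a
Vandermonde system. -/
theorem eq_zero_of_commute_of_trace_mul_pow_eq_zero {K : Type*} [Field K]
    {M Y : Matrix (Fin n) (Fin n) K} {c : Fin n → K} (hc : Function.Injective c)
    (hM : ∀ i, c i ∈ spectrum K M) (hcomm : Commute M Y)
    (htr : ∀ k < n, (Y * M ^ k).trace = 0) : Y = 0 := by
  have hev : ∀ i, ∃ v, Module.End.HasEigenvector (Matrix.toLin' M) (c i) v := fun i ↦ by
    refine Module.End.HasEigenvalue.exists_hasEigenvector ?_
    rw [Module.End.hasEigenvalue_iff_mem_spectrum, Matrix.spectrum_toLin']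
    exact hM i
  choose v hv using hev
  have hli := Module.End.eigenvectors_linearIndependent' _ c hc v hv
  set P : Matrix (Fin n) (Fin n) K := (Matrix.of v)ᵀ with hP
  have hPu : IsUnit P := Matrix.linearIndependent_cols_iff_isUnit.mp hli
  obtain ⟨u, hu⟩ := hPu
  have hMP : M * P = P * diagonal c := by
    ext i j
    have := congrFun (hv j).apply_eq_smul i
    rw [Matrix.mul_diagonal]
    simpa [Matrix.toLin'_apply, Matrix.mulVec, dotProduct, Matrix.mul_apply, hP, mul_comm]
      using this
  rw [← hu] at hMP
  have hMu : M = u.val * diagonal c * u⁻¹.val := by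
    rw [← hMP, mul_assoc, u.mul_inv, mul_one]
  set Z : Matrix (Fin n) (Fin n) K := u⁻¹.val * Y * u.val with hZ
  have hYZ : Y = u.val * Z * u⁻¹.val := by simp [hZ, mul_assoc]
  have hZcomm : diagonal c * Z = Z * diagonal c := by
    have hD : diagonal c = u⁻¹.val * M * u.val := by simp [hMu, mul_assoc]
    have h := hcomm.eq
    rw [hD, hZ]
    calc u⁻¹.val * M * u.val * (u⁻¹.val * Y * u.val) = u⁻¹.val * (M * Y) * u.val := by
          simp [mul_assoc]
      _ = u⁻¹.val * Y * u.val * (u⁻¹.val * M * u.val) := by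
          rw [h]; simp [mul_assoc]
  have hoff : ∀ i j, i ≠ j → Z i j = 0 := fun i j hij ↦ by
    have h := congrFun (congrFun hZcomm i) j
    rw [Matrix.diagonal_mul, Matrix.mul_diagonal, mul_comm (Z i j), ← sub_eq_zero, ← sub_mul] at h
    exact (mul_eq_zero.mp h).resolve_left (sub_ne_zero.mpr fun h ↦ hij (hc h))
  have hdiag : (fun i ↦ Z i i) = 0 := by
    refine Matrix.eq_zero_of_forall_pow_sum_mul_pow_eq_zero hc fun k ↦ ?_
    have h := htr k k.2
    have hconj : Y * M ^ (k : ℕ) = u.val * (Z * diagonal (c ^ (k : ℕ))) * u⁻¹.val := by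
      rw [hMu, Units.conj_pow, hYZ, Matrix.diagonal_pow]
      simp [mul_assoc]
    rw [hconj, Matrix.trace_mul_comm, ← mul_assoc, u.inv_mul, one_mul] at h
    simpa [Matrix.trace, Matrix.mul_diagonal] using h
  have hZ0 : Z = 0 := by
    ext i j
    by_cases hij : i = j
    · subst hij; exact congrFun hdiag i
    · exact hoff i j hij
  rw [hYZ, hZ0, mul_zero, zero_mul]

theorem HasDistinctEigenvalues.hasNSMP {A : Matrix (Fin n) (Fin n) ℝ}
    (hA : HasDistinctEigenvalues A) : HasNSMP A := by
  intro X _ hcomm htr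
  have e : Fin n ≃ spectrum ℂ (A.map ((↑) : ℝ → ℂ)) :=
    (Finite.equivFinOfCardEq (by rw [Nat.card_coe_set_eq]; exact hA)).symm
  have h0 : Xᵀ.map ((↑) : ℝ → ℂ) = 0 := by
    refine eq_zero_of_commute_of_trace_mul_pow_eq_zero (c := fun i ↦ (e i : ℂ))
      (Subtype.val_injective.comp e.injective) (fun i ↦ (e i).2) ?_ fun k hk ↦ ?_
    · exact (show Commute A Xᵀ from sub_eq_zero.mp hcomm).map Complex.ofRealHom.mapMatrix
    · have h : (Xᵀ.map ((↑) : ℝ → ℂ)) * (A.map ((↑) : ℝ → ℂ)) ^ k =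
          Complex.ofRealHom.mapMatrix (Xᵀ * A ^ k) := by
        rw [map_mul, map_pow]; rfl
      rw [h, RingHom.mapMatrix_apply, ← AddMonoidHom.map_trace, htr k hk, map_zero]
  ext i j
  simpa using congrFun (congrFun h0 j) i

/-! ### Density of distinct eigenvalues -/

/-- The resultant of the characteristic polynomial and its derivative varies polynomially along the
line from `A` to `diag(0, …, n - 1)` and does not vanish at the far end, so it has only finitely
many zeros on that line. -/
theorem dense_separable_charpoly_line (A : Matrix (Fin n) (Fin n) ℝ) :
    Dense {t : ℝ |
      (A + t • (diagonal (fun i : Fin n ↦ ((i : ℕ) : ℝ)) - A)).charpoly.Separable} := by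
  set N : Matrix (Fin n) (Fin n) ℝ := diagonal fun i : Fin n ↦ ((i : ℕ) : ℝ) with hN
  set B : Matrix (Fin n) (Fin n) ℝ[X] := A.map C + (X : ℝ[X]) • (N - A).map C with hB
  set r : ℝ[X] := B.charpoly.resultant (derivative B.charpoly) n (n - 1) with hr
  have key : ∀ t : ℝ, (A + t • (N - A)).charpoly.Separable ↔ r.eval t ≠ 0 := fun t ↦ by
    have hBt : A + t • (N - A) = B.map (evalRingHom t) := by
      ext i j
      simp [hB]
    rw [Polynomial.Separable, ← isUnit_resultant_iff_isCoprime (Matrix.charpoly_monic _),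
      natDegree_derivative, Matrix.charpoly_natDegree_eq_dim, Fintype.card_fin, isUnit_iff_ne_zero,
      hBt, Matrix.charpoly_map, derivative_map, resultant_map_map, ← hr, coe_evalRingHom]
  have hr0 : r ≠ 0 := by
    intro h0
    refine (key 1).mp ?_ (by rw [h0, eval_zero])
    rw [one_smul, add_sub_cancel, hN, Matrix.charpoly_diagonal, separable_prod_X_sub_C_iff]
    exact fun i j h ↦ Fin.ext (Nat.cast_injective h)
  have hfin : {t : ℝ | r.eval t = 0}.Countable := (Polynomial.finite_setOfPred_isRoot hr0).countable
  convert hfin.dense_compl ℝ using 1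
  ext t
  exact key t

/-! ### The deformation and its derivative -/

section Deformation

variable {R ι : Type*} [NormedRing R] [NormedAlgebra ℝ R] [CompleteSpace R] [Fintype ι]

/-- Perturb `a` in the directions of the image of `L`, apply the polynomial
`x + ∑ k, c k * x ^ e k`, and conjugate by `1 + y`. The inverse is
`Ring.inverse`, which is the true inverse for `y` near `0` and the junk value `0` where `1 + y` is
not a unit. -/
noncomputable def deformation (a : R) (L : R →L[ℝ] R) (e : ι → ℕ) (x : R × R × (ι → ℝ)) : R :=
  (1 + x.2.1) * (a + L x.1 + ∑ k, x.2.2 k • (a + L x.1) ^ e k) * Ring.inverse (1 + x.2.1)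

/-- At the origin the derivative in `y` of the conjugation is the commutator with `a`, and the
derivative in the coefficients is the corresponding combination of powers of `a`. -/
theorem exists_hasStrictFDerivAt_deformation (a : R) (L : R →L[ℝ] R) (e : ι → ℕ) :
    ∃ f' : R × R × (ι → ℝ) →L[ℝ] R, HasStrictFDerivAt (deformation a L e) f' 0 ∧
      ∀ x, f' x = L x.1 + (x.2.1 * a - a * x.2.1) + ∑ k, x.2.2 k • a ^ e k := by
  have h1 : HasStrictFDerivAt (fun x : R × R × (ι → ℝ) ↦ x.1)
      (ContinuousLinearMap.fst ℝ R (R × (ι → ℝ))) 0 := hasStrictFDerivAt_fst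
  have hs : HasStrictFDerivAt (fun x : R × R × (ι → ℝ) ↦ x.2)
      (ContinuousLinearMap.snd ℝ R (R × (ι → ℝ))) 0 := hasStrictFDerivAt_snd
  have h2 : HasStrictFDerivAt (fun x : R × R × (ι → ℝ) ↦ 1 + x.2.1)
      ((ContinuousLinearMap.fst ℝ R (ι → ℝ)).comp (ContinuousLinearMap.snd ℝ R (R × (ι → ℝ)))) 0 :=
    hs.fst.const_add 1
  have h3 : ∀ k, HasStrictFDerivAt (fun x : R × R × (ι → ℝ) ↦ x.2.2 k)
      ((ContinuousLinearMap.proj k).comp ((ContinuousLinearMap.snd ℝ R (ι → ℝ)).comp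
        (ContinuousLinearMap.snd ℝ R (R × (ι → ℝ))))) 0 := fun k ↦
    ((ContinuousLinearMap.proj (R := ℝ) (φ := fun _ : ι ↦ ℝ) k).hasStrictFDerivAt).comp 0 hs.snd
  have hL : HasStrictFDerivAt (fun x : R × R × (ι → ℝ) ↦ a + L x.1)
      (L.comp (ContinuousLinearMap.fst ℝ R (R × (ι → ℝ)))) 0 :=
    ((L.hasStrictFDerivAt).comp 0 h1).const_add a
  -- Only the existence of this derivative matters: in the product rule it is multiplied by the
  -- coefficient `x.2.2 k`, which vanishes at the origin.
  have hpow : ∀ k, ∃ g' : R × R × (ι → ℝ) →L[ℝ] R,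
      HasStrictFDerivAt (fun x : R × R × (ι → ℝ) ↦ (a + L x.1) ^ e k) g' 0 := fun k ↦ by
    have hc : ContDiffAt ℝ 1 (fun x : R × R × (ι → ℝ) ↦ (a + L x.1) ^ e k) 0 := by fun_prop
    exact ⟨_, hc.hasStrictFDerivAt one_ne_zero⟩
  choose g' hg' using hpow
  have hsum := HasStrictFDerivAt.fun_sum (u := Finset.univ) fun k _ ↦ (h3 k).smul (hg' k)
  have hinv : HasStrictFDerivAt (fun x : R × R × (ι → ℝ) ↦ Ring.inverse (1 + x.2.1)) _ 0 :=
    HasStrictFDerivAt.comp (g := Ring.inverse) (0 : R × R × (ι → ℝ))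
      (by simpa using hasStrictFDerivAt_ringInverse (𝕜 := ℝ) (1 : Rˣ)) h2
  refine ⟨_, (h2.mul' (hL.add hsum)).mul' hinv, fun x ↦ ?_⟩
  simp
  abel

end Deformation

/-! ### The nSMP as a spanning condition -/

/-- The projection of a matrix onto the entries at which `A` does not vanish. -/
noncomputable def supportProj (A : Matrix (Fin n) (Fin n) ℝ) :
    Matrix (Fin n) (Fin n) ℝ →ₗ[ℝ] Matrix (Fin n) (Fin n) ℝ where
  toFun D := Matrix.of fun i j ↦ if A i j = 0 then 0 else D i j
  map_add' D E := by ext i j; by_cases h : A i j = 0 <;> simp [h]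
  map_smul' c D := by ext i j; by_cases h : A i j = 0 <;> simp [h]

theorem supportProj_apply (A D : Matrix (Fin n) (Fin n) ℝ) (i j : Fin n) :
    supportProj A D i j = if A i j = 0 then 0 else D i j := rfl

theorem exists_trace_transpose_mul_eq (φ : Matrix (Fin n) (Fin n) ℝ →ₗ[ℝ] ℝ) :
    ∃ X : Matrix (Fin n) (Fin n) ℝ, ∀ Z, φ Z = (Xᵀ * Z).trace := by
  refine ⟨Matrix.of fun i j ↦ φ (Matrix.single i j 1), fun Z ↦ ?_⟩
  conv_lhs => rw [Matrix.matrix_eq_sum_single Z]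
  simp only [map_sum, Matrix.trace, Matrix.diag_apply, Matrix.mul_apply, Matrix.transpose_apply,
    Matrix.of_apply]
  rw [Finset.sum_comm]
  refine Finset.sum_congr rfl fun j _ ↦ Finset.sum_congr rfl fun i _ ↦ ?_
  rw [show Matrix.single i j (Z i j) = Z i j • Matrix.single i j (1 : ℝ) by
    rw [Matrix.smul_single, smul_eq_mul, mul_one], map_smul, smul_eq_mul, mul_comm]

theorem eq_zero_of_forall_trace_mul_eq_zero {Y : Matrix (Fin n) (Fin n) ℝ}
    (h : ∀ Z, (Y * Z).trace = 0) : Y = 0 := by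
  ext i j
  simpa [Matrix.trace_mul_single] using h (Matrix.single j i 1)

/-- The three conditions in the non-symmetric strong multiplicity property say that `X` is
orthogonal, for the form `tr (Xᵀ Z)`, to the matrices supported on the pattern of `A`, to the
commutators with `A`, and to the powers of `A`. The property thus says that these three spaces
together span all matrices. -/
theorem HasNSMP.range_eq_top {A : Matrix (Fin n) (Fin n) ℝ} (hA : HasNSMP A)
    (f : Matrix (Fin n) (Fin n) ℝ × Matrix (Fin n) (Fin n) ℝ × (Fin n → ℝ) →ₗ[ℝ]
      Matrix (Fin n) (Fin n) ℝ)
    (hf : ∀ x, f x = supportProj A x.1 + (x.2.1 * A - A * x.2.1) +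
      ∑ k : Fin n, x.2.2 k • A ^ (k : ℕ)) :
    LinearMap.range f = ⊤ := by
  by_contra hne
  obtain ⟨φ, hφ, hle⟩ := Submodule.exists_le_ker_of_lt_top _ (lt_top_iff_ne_top.mpr hne)
  obtain ⟨X, hX⟩ := exists_trace_transpose_mul_eq φ
  have hker : ∀ x, (Xᵀ * f x).trace = 0 := fun x ↦ by
    rw [← hX]; exact hle (LinearMap.mem_range_self f x)
  refine hφ (LinearMap.ext fun Z ↦ ?_)
  rw [hX, hA X ?_ ?_ ?_]
  · simp
  · ext i j
    by_cases hij : A i j = 0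
    · simp [hij]
    have h := hker (Matrix.single i j 1, 0, 0)
    have hs : supportProj A (Matrix.single i j 1) = Matrix.single i j 1 := by
      ext i' j'
      rw [supportProj_apply]
      split_ifs with h0
      · rw [Matrix.single_apply_of_ne]
        rintro ⟨rfl, rfl⟩
        exact hij h0
      · rfl
    simp [hf, hs, Matrix.trace_mul_single] at h
    simp [h]
  · refine eq_zero_of_forall_trace_mul_eq_zero fun Y ↦ ?_
    have h := hker (0, Y, 0)
    simp only [hf, map_zero, zero_add, Pi.zero_apply, zero_smul, Finset.sum_const_zero,
      add_zero] at h
    rw [mul_sub, Matrix.trace_sub] at h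
    rwa [sub_mul, Matrix.trace_sub, mul_assoc, Matrix.trace_mul_comm, mul_assoc, mul_assoc]
  · intro k hk
    have h := hker (0, 0, Pi.single ⟨k, hk⟩ 1)
    simpa [hf, Pi.single_apply] using h

/-! ### Finding distinct eigenvalues in the pattern -/

open scoped Matrix.Norms.Operator in
/-- The derivative of the deformation of `A` at the origin is onto, so the deformation covers a
neighbourhood of `A`, which contains matrices with distinct eigenvalues. The perturbation of `A`
underlying such a matrix already has distinct eigenvalues, because neither conjugation nor
evaluation of a polynomial can increase the number of eigenvalues. -/
theorem HasNSMP.exists_sign_eq_hasDistinctEigenvalues {A : Matrix (Fin n) (Fin n) ℝ}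
    (hA : HasNSMP A) : ∃ B : Matrix (Fin n) (Fin n) ℝ,
      (∀ i j, SignType.sign (B i j) = SignType.sign (A i j)) ∧ HasDistinctEigenvalues B := by
  set L : Matrix (Fin n) (Fin n) ℝ →L[ℝ] Matrix (Fin n) (Fin n) ℝ :=
    LinearMap.toContinuousLinearMap (supportProj A)
  have hLapp : ∀ D, L D = supportProj A D := fun D ↦ rfl
  set F := deformation A L (fun k : Fin n ↦ (k : ℕ)) with hF
  obtain ⟨f', hf', hf'app⟩ := exists_hasStrictFDerivAt_deformation A L (fun k : Fin n ↦ (k : ℕ))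
  have hF0 : F 0 = A := by
    have hL0 : L 0 = 0 := map_zero (supportProj A)
    simp only [hF, deformation, Prod.fst_zero, Prod.snd_zero, Pi.zero_apply, zero_smul,
      Finset.sum_const_zero, add_zero, Ring.inverse_one, one_mul, mul_one]
    exact (congrArg (A + ·) hL0).trans (add_zero A)
  have hmap : Filter.map F (nhds 0) = nhds A := by
    rw [← hF0]
    exact hf'.map_nhds_eq_of_surj (hA.range_eq_top _ hf'app)
  have hdense : ∃ᶠ M in nhds A, HasDistinctEigenvalues M := by
    have hcont : Continuous fun t : ℝ ↦
        A + t • (diagonal (fun i : Fin n ↦ ((i : ℕ) : ℝ)) - A) := by fun_prop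
    have h0 := hcont.tendsto 0
    simp only [zero_smul, add_zero] at h0
    refine h0.frequently ?_
    simp only [hasDistinctEigenvalues_iff_separable]
    exact mem_closure_iff_frequently.mp (dense_separable_charpoly_line A 0)
  rw [← hmap, Filter.frequently_map] at hdense
  have hunit : ∀ᶠ x : Matrix (Fin n) (Fin n) ℝ × Matrix (Fin n) (Fin n) ℝ × (Fin n → ℝ) in nhds 0,
      IsUnit (1 + x.2.1) := by
    have hc : Continuous fun x : Matrix (Fin n) (Fin n) ℝ × Matrix (Fin n) (Fin n) ℝ ×
        (Fin n → ℝ) ↦ 1 + x.2.1 := by fun_prop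
    exact hc.continuousAt.eventually (Units.isOpen.mem_nhds (by simp))
  have hsign : ∀ᶠ x : Matrix (Fin n) (Fin n) ℝ × Matrix (Fin n) (Fin n) ℝ × (Fin n → ℝ) in nhds 0,
      ∀ i j, SignType.sign ((A + L x.1) i j) = SignType.sign (A i j) := by
    refine Filter.eventually_all.mpr fun i ↦ Filter.eventually_all.mpr fun j ↦ ?_
    -- The perturbation `L x.1` vanishes where `A` does, so only nonzero entries can change sign,
    -- and they keep it near the origin.
    by_cases hij : A i j = 0
    · refine Filter.Eventually.of_forall fun x ↦ ?_
      rw [Matrix.add_apply, hLapp, supportProj_apply, if_pos hij, add_zero]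
    · have hc : Continuous fun x : Matrix (Fin n) (Fin n) ℝ × Matrix (Fin n) (Fin n) ℝ ×
          (Fin n → ℝ) ↦ (A + L x.1) i j :=
        ((Matrix.entryLinearMap ℝ ℝ i j).continuous_of_finiteDimensional).comp
          (continuous_const.add (L.continuous.comp continuous_fst))
      have h0 : (A + L (0 : Matrix (Fin n) (Fin n) ℝ ×
          Matrix (Fin n) (Fin n) ℝ × (Fin n → ℝ)).1) i j = A i j := by simp
      rcases lt_or_gt_of_ne hij with h | h
      · filter_upwards [hc.continuousAt.eventually_lt_const (h0.trans_lt h)] with x hx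
        rw [sign_neg hx, sign_neg h]
      · filter_upwards [hc.continuousAt.eventually_const_lt (h.trans_eq h0.symm)] with x hx
        rw [sign_pos hx, sign_pos h]
  obtain ⟨x, hx, ⟨u, hu⟩, hs⟩ := (hdense.and_eventually (hunit.and hsign)).exists
  refine ⟨A + L x.1, hs, hasDistinctEigenvalues_of_aeval
    (X + ∑ k : Fin n, C (x.2.2 k) * X ^ (k : ℕ)) (hasDistinctEigenvalues_of_units_conj u ?_)⟩
  convert hx using 1
  simp [hF, deformation, ← hu, Algebra.smul_def]
  -- What remains agrees up to unfolding instances.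
  rfl

end SignPat

theorem mainTheorem1 (n : ℕ) (𝒜 : SignPat.SignPattern n) :
    (SignPat.Allows 𝒜 SignPat.HasNSMP ↔ SignPat.Allows 𝒜 SignPat.HasDistinctEigenvalues) ∧
      ∀ A : Matrix (Fin n) (Fin n) ℝ, SignPat.HasDistinctEigenvalues A → SignPat.HasNSMP A := by
  refine ⟨⟨fun ⟨A, hA, h⟩ ↦ ?_, fun ⟨A, hA, h⟩ ↦ ⟨A, hA, h.hasNSMP⟩⟩, fun A h ↦ h.hasNSMP⟩
  obtain ⟨B, hB, hdist⟩ := h.exists_sign_eq_hasDistinctEigenvalues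
  exact ⟨B, fun i j ↦ (hB i j).trans (hA i j), hdist⟩
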